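/- **Knitting lemma.** Let $P$ be a metric space and let $(M_x)_{x\in P}$ be a family of complete metric spaces (the value $+\infty$ being allowed for the distances). For continuous maps $f,g$ between two of these spaces put $d(f,g)=\sup_z d(f(z),g(z))\in[0,+\infty]$, and let $\mathrm{Lip}$ denote the (best) Lipschitz constant. Let $(\mu_{xy})_{x,y\in P}$ be a strongly approximate action of the pair groupoid $P\times P$, that is, a family of continuous maps $\mu_{xy}:M_y\to M_x$ with $\mu_{xx}=\mathrm{Id}_{M_x}$ for which there are real numbers $L\ge 0$, $\varepsilon>0$, $C_i\ge 0$ and $a_i,b_i>0$ with $a_i+b_i=2+\varepsilon$ ($i=1,\dots,n$) such that, for all $x,y,u,v\in P$, $$\mathrm{Lip}(\mu_{xy})\le 1+L\,d_P(x,y),$$ $$d\big(\mu_{xu}\circ\mu_{uy},\,\mu_{xv}\circ\mu_{vy}\big)\le \big(1+L\,d_P(u,x)\big)\sum_{i=1}^n C_i\,d_P(y,v)^{a_i}d_P(u,v)^{b_i}+\sum_{i=1}^n C_i\,d_P(x,u)^{b_i}d_P(u,v)^{a_i}.$$ Let $\mathcal G_P^{\mathrm{Lip}}$ be the Lipschitz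 homotopy groupoid of $P$: its objects are the points of $P$, its morphisms from $x$ to $y$ are the Lipschitz paths $\gamma:[0,1]\to P$ from $x$ to $y$ modulo homotopies $[0,1]^2\to P$ with fixed endpoints that are Lipschitz, and its composition is concatenation of paths. A continuous action $\varphi$ of it on $(M_x)$ is a family of continuous maps $\varphi_{\mathbf g}:M_x\to M_y$, one for each morphism $\mathbf g$ from $x$ to $y$, such that constant paths act by the identity and $\varphi_{\mathbf g\mathbf g'}=\varphi_{\mathbf g}\circ\varphi_{\mathbf g'}$, where $\mathbf g\mathbf g'$ is $\mathbf g'$ followed by $\mathbf g$. For a Lipschitz path $\gamma$ and $s,t\in[0,1]$ let $\gamma_{st}(u)=\gamma\big(su+t(1-u)\big)$, a path from $\gamma(t)$ to $\gamma(s)$, and write $\varphi_{\gamma_{st}}$ for the map given by its class. Then there is a unique continuous action $\varphi$ of $\mathcal G_P^{\mathrm{Lip}}$ on $(M_x)$ such that for every Lipschitz path $\gamma:[0,1]\to P$ there is a constant $C'$ with $$d\big(\varphi_{\gamma_{st}},\,\mu_{\gamma(s)\gamma(t)}\big)\le C'\,|t-s|^{1+\varepsilon}\qquad\text{for all } s,t\in[0,1].$$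 Moreover, for every Lipschitz path $\gamma$ and all $s,t\in[0,1]$: 1. the estimate above holds with $$C'=2^{1+\varepsilon}\,\mathrm{Lip}(\gamma)^{2+\varepsilon}\,e^{L\,\mathrm{Lip}(\gamma)|t-s|}\Big(\sum_{i=1}^nC_i\Big)\zeta(2+\varepsilon),$$ where $\zeta$ is the Riemann zeta function; 2. $\varphi_{\gamma_{st}}$ is the limit, for the uniform distance $d$, of the compositions $\mu_{\gamma(s)\gamma(t_1)}\circ\mu_{\gamma(t_1)\gamma(t_2)}\circ\cdots\circ\mu_{\gamma(t_{k-1})\gamma(t)}$ when the mesh of the (increasing or decreasing) subdivision $(s,t_1,\dots,t_{k-1},t)$ of the interval between $s$ and $t$ tends to zero; 3. $\mathrm{Lip}(\varphi_{\gamma_{st}})\le e^{L\,\mathrm{Lip}(\gamma)|t-s|}$. -/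

import Mathlib

open scoped unitInterval ENNReal NNReal

noncomputable section

namespace Knitting

/-! ### Distances between continuous maps and Lipschitz constants -/

/-- The (possibly infinite) uniform distance `sup_z d (f z, g z)` between two continuous maps. -/
def supDist {X Y : Type*} [TopologicalSpace X] [EMetricSpace Y] (f g : C(X, Y)) : ℝ≥0∞ :=
  ⨆ z, edist (f z) (g z)

/-- The (possibly infinite) Lipschitz constant `sup_{z ≠ w} d (f z, f w) / d (z, w)`.
A pair at infinite distance contributes `0`. -/
def lipConst {X Y : Type*} [EMetricSpace X] [EMetricSpace Y] (f : X → Y) : ℝ≥0∞ :=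
  ⨆ (z : X) (w : X) (_ : z ≠ w), edist (f z) (f w) / edist z w

/-- `f` is Lipschitz, for some finite constant. -/
def IsLip {X Y : Type*} [PseudoEMetricSpace X] [PseudoEMetricSpace Y] (f : X → Y) : Prop :=
  ∃ K : ℝ≥0, LipschitzWith K f

namespace IsLip

theorem comp {X Y Z : Type*} [PseudoEMetricSpace X] [PseudoEMetricSpace Y] [PseudoEMetricSpace Z]
    {g : Y → Z} {f : X → Y} (hg : IsLip g) (hf : IsLip f) : IsLip (fun x => g (f x)) := by
  obtain ⟨K, hK⟩ := hg
  obtain ⟨K', hK'⟩ := hf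
  exact ⟨K * K', hK.comp hK'⟩

theorem prodMk {X Y Z : Type*} [PseudoEMetricSpace X] [PseudoEMetricSpace Y] [PseudoEMetricSpace Z]
    {f : X → Y} {g : X → Z} (hf : IsLip f) (hg : IsLip g) : IsLip (fun x => (f x, g x)) := by
  obtain ⟨K, hK⟩ := hf
  obtain ⟨K', hK'⟩ := hg
  exact ⟨max K K', hK.prodMk hK'⟩

theorem fst {X Y : Type*} [PseudoEMetricSpace X] [PseudoEMetricSpace Y] :
    IsLip (Prod.fst : X × Y → X) := ⟨1, LipschitzWith.prod_fst⟩

theorem snd {X Y : Type*} [PseudoEMetricSpace X] [PseudoEMetricSpace Y] :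
    IsLip (Prod.snd : X × Y → Y) := ⟨1, LipschitzWith.prod_snd⟩

theorem of_dist_le {X Y : Type*} [PseudoMetricSpace X] [PseudoMetricSpace Y] {f : X → Y} (K : ℝ)
    (h : ∀ x y, dist (f x) (f y) ≤ K * dist x y) : IsLip f :=
  ⟨Real.toNNReal K, LipschitzWith.of_dist_le' h⟩

/-- A map that agrees with one Lipschitz map where `c ≤ 1/2` and with another one where
`1/2 ≤ c` is Lipschitz, if the two parts can be joined through `c = 1/2`. -/
theorem glue {X Y : Type*} [PseudoMetricSpace X] [PseudoMetricSpace Y] {h g₁ g₂ : X → Y}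
    (c : X → ℝ) (hg₁ : IsLip g₁) (hg₂ : IsLip g₂) (h₁ : ∀ x, c x ≤ 1 / 2 → h x = g₁ x)
    (h₂ : ∀ x, 1 / 2 ≤ c x → h x = g₂ x)
    (mid : ∀ x y, c x ≤ 1 / 2 → 1 / 2 ≤ c y →
      ∃ z, c z = 1 / 2 ∧ dist x z ≤ dist x y ∧ dist z y ≤ dist x y) : IsLip h := by
  obtain ⟨K₁, hK₁⟩ := hg₁
  obtain ⟨K₂, hK₂⟩ := hg₂
  have cross : ∀ x y, c x ≤ 1 / 2 → 1 / 2 ≤ c y → dist (h x) (h y) ≤ (K₁ + K₂ : ℝ) * dist x y := by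
    intro x y hx hy
    obtain ⟨z, hz, hxz, hzy⟩ := mid x y hx hy
    have a₁ : dist (h x) (h z) ≤ K₁ * dist x y := by
      rw [h₁ x hx, h₁ z hz.le]
      exact (hK₁.dist_le_mul x z).trans (by gcongr)
    have a₂ : dist (h z) (h y) ≤ K₂ * dist x y := by
      rw [h₂ y hy, h₂ z hz.ge]
      exact (hK₂.dist_le_mul z y).trans (by gcongr)
    linarith [dist_triangle (h x) (h z) (h y)]
  refine of_dist_le (K₁ + K₂ : ℝ) fun x y => ?_
  have d₁ : 0 ≤ (K₁ : ℝ) * dist x y := by positivity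
  have d₂ : 0 ≤ (K₂ : ℝ) * dist x y := by positivity
  rcases le_total (c x) (1 / 2) with hx | hx <;> rcases le_total (c y) (1 / 2) with hy | hy
  · rw [h₁ x hx, h₁ y hy]
    linarith [hK₁.dist_le_mul x y]
  · exact cross x y hx hy
  · rw [dist_comm, dist_comm x]
    exact cross y x hy hx
  · rw [h₂ x hx, h₂ y hy]
    linarith [hK₂.dist_le_mul x y]

theorem affine_I (a b : ℝ) : IsLip (fun t : I => a * (t : ℝ) + b) := by
  refine of_dist_le |a| fun x y => ?_
  rw [Subtype.dist_eq, Real.dist_eq, Real.dist_eq, ← abs_mul]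
  exact le_of_eq (by ring_nf)

/-- Clamped affine maps of the unit interval are Lipschitz. -/
theorem projIcc_affine (a b : ℝ) :
    IsLip (fun t : I => Set.projIcc (0 : ℝ) 1 zero_le_one (a * t + b)) := by
  exact comp ⟨1, LipschitzWith.projIcc zero_le_one⟩ (affine_I a b)

theorem coe_I : IsLip (fun t : I => (t : ℝ)) := ⟨1, LipschitzWith.subtype_val _⟩

theorem const {X : Type*} [PseudoEMetricSpace X] (c : ℝ) : IsLip (fun _ : X => c) :=
  ⟨0, LipschitzWith.const c⟩

theorem add {X : Type*} [PseudoEMetricSpace X] {f g : X → ℝ} (hf : IsLip f) (hg : IsLip g) :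
    IsLip (fun x => f x + g x) := by
  obtain ⟨K, hK⟩ := hf
  obtain ⟨K', hK'⟩ := hg
  exact ⟨K + K', hK.add hK'⟩

theorem min {X : Type*} [PseudoEMetricSpace X] {f g : X → ℝ} (hf : IsLip f) (hg : IsLip g) :
    IsLip (fun x => Min.min (f x) (g x)) := by
  obtain ⟨K, hK⟩ := hf
  obtain ⟨K', hK'⟩ := hg
  exact ⟨Max.max K K', hK.min hK'⟩

theorem mul {X : Type*} [PseudoMetricSpace X] {f g : X → ℝ} (hf : IsLip f) (hg : IsLip g)
    (bf : ∀ x, |f x| ≤ 1) (bg : ∀ x, |g x| ≤ 1) : IsLip (fun x => f x * g x) := by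
  obtain ⟨K, hK⟩ := hf
  obtain ⟨K', hK'⟩ := hg
  refine of_dist_le (K + K' : ℝ) fun x y => ?_
  have e : f x * g x - f y * g y = f x * (g x - g y) + (f x - f y) * g y := by ring
  have h₁ := hK.dist_le_mul x y
  have h₂ := hK'.dist_le_mul x y
  rw [Real.dist_eq] at h₁ h₂ ⊢
  rw [e]
  refine (abs_add_le _ _).trans ?_
  rw [abs_mul, abs_mul]
  have := mul_le_of_le_one_left (abs_nonneg (g x - g y)) (bf x)
  have := mul_le_of_le_one_right (abs_nonneg (f x - f y)) (bg y)
  linarith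

theorem abs_I_le (t : I) : |(t : ℝ)| ≤ 1 := abs_le.mpr ⟨by linarith [t.2.1], t.2.2⟩

theorem symm_I : IsLip (fun t : I => unitInterval.symm t) :=
  of_dist_le 1 fun s t => by
    simp only [Subtype.dist_eq, Real.dist_eq, unitInterval.coe_symm_eq, one_mul]
    rw [abs_sub_comm]
    exact le_of_eq (by ring_nf)

theorem mid_I (x y : I) (hx : (x : ℝ) ≤ 1 / 2) (hy : 1 / 2 ≤ (y : ℝ)) :
    ∃ z : I, (z : ℝ) = 1 / 2 ∧ dist x z ≤ dist x y ∧ dist z y ≤ dist x y := by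
  refine ⟨⟨1 / 2, by norm_num, by norm_num⟩, rfl, ?_, ?_⟩ <;>
  · rw [Subtype.dist_eq, Subtype.dist_eq, Real.dist_eq, Real.dist_eq,
      abs_of_nonpos (by simpa using by linarith), abs_of_nonpos (by linarith)]
    simp only
    linarith

end IsLip

/-! ### Lipschitz paths and Lipschitz homotopies -/

/-- A Lipschitz path `[0,1] → P` from `x` to `y`. -/
structure LipPath {P : Type*} [MetricSpace P] (x y : P) where
  /-- the underlying path -/
  toPath : Path x y
  isLip : IsLip toPath

/-- Lipschitz homotopy with fixed endpoints: a homotopy `H : [0,1] × [0,1] → P` of paths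
that is a Lipschitz map. -/
def LipHomotopic {P : Type*} [MetricSpace P] {x y : P} (γ₀ γ₁ : LipPath x y) : Prop :=
  ∃ H : γ₀.toPath.Homotopy γ₁.toPath, IsLip H

namespace LipPath

variable {P : Type*} [MetricSpace P] {x y z w : P}

instance : CoeFun (LipPath x y) (fun _ => I → P) := ⟨fun γ => γ.toPath⟩

/-- The Lipschitz constant of a Lipschitz path, as a real number. -/
def lip (γ : LipPath x y) : ℝ := (lipConst γ).toReal

/-- The constant path. -/
def refl (x : P) : LipPath x x where
  toPath := Path.refl x
  isLip := ⟨0, LipschitzWith.const x⟩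

/-- The reversed path. -/
def symm (γ : LipPath x y) : LipPath y x where
  toPath := γ.toPath.symm
  isLip := γ.isLip.comp IsLip.symm_I

theorem extend_isLip (γ : LipPath x y) (a b : ℝ) :
    IsLip (fun t : I => γ.toPath.extend (a * t + b)) :=
  γ.isLip.comp (IsLip.projIcc_affine a b)

/-- Concatenation: first `γ`, then `γ'`. -/
def trans (γ : LipPath x y) (γ' : LipPath y z) : LipPath x z where
  toPath := γ.toPath.trans γ'.toPath
  isLip := by
    refine IsLip.glue (fun t : I => (t : ℝ)) (γ.extend_isLip 2 0) (γ'.extend_isLip 2 (-1))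
      ?_ ?_ IsLip.mid_I
    · intro t ht
      simp only [Path.trans, Path.coe_mk', ContinuousMap.coe_mk, Function.comp_apply, if_pos ht,
        add_zero]
    · intro t ht
      rcases ht.eq_or_lt with h | h
      · simp [Path.trans, ← h]
      · simp [Path.trans, not_le.mpr (by simpa using h), sub_eq_add_neg]

/-- For `t₀, t₁ ∈ [0,1]`, the path `u ↦ γ ((1 - u) t₀ + u t₁)` from `γ t₀` to `γ t₁`. -/
def subpath (γ : LipPath x y) (t₀ t₁ : I) : LipPath (γ t₀) (γ t₁) where
  toPath := γ.toPath.subpath t₀ t₁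
  isLip := by
    obtain ⟨K, hK⟩ := IsLip.affine_I ((t₁ : ℝ) - t₀) t₀
    refine γ.isLip.comp ⟨K, fun u v => ?_⟩
    have e : ∀ w : I, ((t₁ : ℝ) - t₀) * w + t₀ = (Set.Icc.convexComb t₀ t₁ w : ℝ) := fun w => by
      rw [Set.Icc.coe_convexComb]
      ring
    have h := hK u v
    simp only [e] at h
    exact h

end LipPath

namespace LipHomotopic

variable {P : Type*} [MetricSpace P] {x y z w : P}

theorem refl (γ : LipPath x y) : LipHomotopic γ γ :=
  ⟨Path.Homotopy.refl _, γ.isLip.comp IsLip.snd⟩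

theorem symm {γ₀ γ₁ : LipPath x y} (h : LipHomotopic γ₀ γ₁) : LipHomotopic γ₁ γ₀ := by
  obtain ⟨H, hH⟩ := h
  exact ⟨H.symm, hH.comp ((IsLip.symm_I.comp IsLip.fst).prodMk IsLip.snd)⟩

theorem symm₂ {γ₀ γ₁ : LipPath x y} (h : LipHomotopic γ₀ γ₁) :
    LipHomotopic γ₀.symm γ₁.symm := by
  obtain ⟨H, hH⟩ := h
  exact ⟨H.symm₂, hH.comp (IsLip.fst.prodMk (IsLip.symm_I.comp IsLip.snd))⟩

theorem trans {γ₀ γ₁ γ₂ : LipPath x y} (h : LipHomotopic γ₀ γ₁) (h' : LipHomotopic γ₁ γ₂) :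
    LipHomotopic γ₀ γ₂ := by
  obtain ⟨F, hF⟩ := h
  obtain ⟨G, hG⟩ := h'
  refine ⟨F.trans G, IsLip.glue (fun p : I × I => (p.1 : ℝ))
    (hF.comp (((IsLip.projIcc_affine 2 0).comp IsLip.fst).prodMk IsLip.snd))
    (hG.comp (((IsLip.projIcc_affine 2 (-1)).comp IsLip.fst).prodMk IsLip.snd)) ?_ ?_ ?_⟩
  · intro p hp
    rw [Path.Homotopy.trans_apply, dif_pos hp]
    congr 2
    rw [add_zero, Set.projIcc_of_mem]
  · intro p hp
    rcases hp.eq_or_lt with h | h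
    · rw [Path.Homotopy.trans_apply, dif_pos h.ge]
      have e₁ : (⟨2 * p.1, (unitInterval.mul_pos_mem_iff zero_lt_two).2 ⟨p.1.2.1, h.ge⟩⟩ : I) = 1 :=
        Subtype.ext (by simp [← h])
      have e₀ : Set.projIcc (0 : ℝ) 1 zero_le_one (2 * p.1 + -1) = 0 := by simp [← h]
      rw [e₁, e₀, F.apply_one, G.apply_zero]
    · rw [Path.Homotopy.trans_apply, dif_neg (not_le.mpr h)]
      congr 2
      rw [← sub_eq_add_neg, Set.projIcc_of_mem]
  · intro p q hp hq
    obtain ⟨m, hm, h₁, h₂⟩ := IsLip.mid_I p.1 q.1 hp hq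
    refine ⟨(m, q.2), hm, ?_, ?_⟩
    · exact max_le_max h₁ le_rfl
    · exact max_le (h₂.trans (le_max_left _ _)) (by simp)

theorem hcomp {γ₀ γ₁ : LipPath x y} {γ₀' γ₁' : LipPath y z} (h : LipHomotopic γ₀ γ₁)
    (h' : LipHomotopic γ₀' γ₁') : LipHomotopic (γ₀.trans γ₀') (γ₁.trans γ₁') := by
  obtain ⟨F, hF⟩ := h
  obtain ⟨G, hG⟩ := h'
  refine ⟨F.hcomp G, IsLip.glue (fun p : I × I => (p.2 : ℝ))
    (hF.comp (IsLip.fst.prodMk ((IsLip.projIcc_affine 2 0).comp IsLip.snd)))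
    (hG.comp (IsLip.fst.prodMk ((IsLip.projIcc_affine 2 (-1)).comp IsLip.snd))) ?_ ?_ ?_⟩
  · intro p hp
    refine (Path.Homotopy.hcomp_apply F G p).trans ?_
    rw [dif_pos hp]
    simp only [add_zero, Path.Homotopy.eval_apply]
    rw [Set.projIcc_of_mem]
    rfl
  · intro p hp
    rcases hp.eq_or_lt with h | h
    · refine (Path.Homotopy.hcomp_apply F G p).trans ?_
      rw [dif_pos h.ge]
      have e₁ : (⟨2 * p.2, (unitInterval.mul_pos_mem_iff zero_lt_two).2 ⟨p.2.2.1, h.ge⟩⟩ : I) = 1 :=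
        Subtype.ext (by simp [← h])
      have e₀ : Set.projIcc (0 : ℝ) 1 zero_le_one (2 * p.2 + -1) = 0 := by simp [← h]
      rw [e₁, e₀, Path.target, G.source]
    · refine (Path.Homotopy.hcomp_apply F G p).trans ?_
      rw [dif_neg (not_le.mpr h)]
      simp only [← sub_eq_add_neg]
      rw [Set.projIcc_of_mem]
      rfl
  · intro p q hp hq
    obtain ⟨m, hm, h₁, h₂⟩ := IsLip.mid_I p.2 q.2 hp hq
    refine ⟨(q.1, m), hm, ?_, ?_⟩
    · exact max_le_max le_rfl h₁
    · exact max_le (by simp) (h₂.trans (le_max_right _ _))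

theorem equivalence : Equivalence (LipHomotopic (x := x) (y := y)) :=
  ⟨refl, symm, trans⟩

/-- A Lipschitz path and a Lipschitz reparametrisation of it are Lipschitz homotopic. -/
theorem reparam (γ γ' : LipPath x y) (f : I → I) (hf : Continuous f) (hf₀ : f 0 = 0)
    (hf₁ : f 1 = 1) (hf' : IsLip fun t => (f t : ℝ))
    (h : γ'.toPath = γ.toPath.reparam f hf hf₀ hf₁) : LipHomotopic γ' γ := by
  refine symm ⟨(Path.Homotopy.reparam γ.toPath f hf hf₀ hf₁).cast rfl h.symm, ?_⟩
  have key : IsLip fun p : I × I => ((unitInterval.symm p.1 : I) : ℝ) * p.2 + p.1 * f p.2 :=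
    ((IsLip.coe_I.comp (IsLip.symm_I.comp IsLip.fst)).mul (IsLip.coe_I.comp IsLip.snd)
      (fun _ => IsLip.abs_I_le _) (fun _ => IsLip.abs_I_le _)).add
    ((IsLip.coe_I.comp IsLip.fst).mul (hf'.comp IsLip.snd)
      (fun _ => IsLip.abs_I_le _) (fun _ => IsLip.abs_I_le _))
  obtain ⟨K, hK⟩ := key
  obtain ⟨K', hK'⟩ := γ.isLip
  refine ⟨K' * K, fun p q => (hK' _ _).trans ?_⟩
  rw [ENNReal.coe_mul, mul_assoc]
  exact mul_le_mul_right (hK p q) _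

theorem trans_refl (γ : LipPath x y) : LipHomotopic (γ.trans (LipPath.refl y)) γ := by
  refine reparam _ _ _ _ _ _ ?_ (Path.Homotopy.trans_refl_reparam γ.toPath)
  convert (IsLip.affine_I 2 0).min (IsLip.const 1) using 2 with t
  simp only [Path.Homotopy.transReflReparamAux]
  grind

theorem refl_trans (γ : LipPath x y) : LipHomotopic ((LipPath.refl x).trans γ) γ := by
  obtain ⟨H, hH⟩ := (trans_refl γ.symm).symm₂
  refine ⟨H.cast (by simp [LipPath.symm, LipPath.trans, LipPath.refl])
    (by simp [LipPath.symm]), hH⟩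

theorem trans_assoc (γ : LipPath x y) (γ' : LipPath y z) (γ'' : LipPath z w) :
    LipHomotopic ((γ.trans γ').trans γ'') (γ.trans (γ'.trans γ'')) := by
  refine reparam _ _ _ _ _ _ ?_
    (Path.Homotopy.trans_assoc_reparam γ.toPath γ'.toPath γ''.toPath)
  convert (IsLip.affine_I 2 0).min ((IsLip.affine_I 1 (1 / 4)).min (IsLip.affine_I (1 / 2) (1 / 2)))
    using 2 with t
  simp only [Path.Homotopy.transAssocReparamAux]
  grind

theorem trans_symm (γ : LipPath x y) : LipHomotopic (γ.trans γ.symm) (LipPath.refl x) := by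
  refine symm ⟨Path.Homotopy.reflTransSymm γ.toPath, ?_⟩
  have key : IsLip Path.Homotopy.reflTransSymmAux := by
    have h : IsLip fun p : I × I => (p.1 : ℝ) * min (2 * (p.2 : ℝ) + 0) (-2 * (p.2 : ℝ) + 2) := by
      refine (IsLip.coe_I.comp IsLip.fst).mul
        (((IsLip.affine_I 2 0).min (IsLip.affine_I (-2) 2)).comp IsLip.snd)
        (fun _ => IsLip.abs_I_le _) (fun p => ?_)
      have := p.2.2.1
      have := p.2.2.2
      grind
    convert h using 2 with p
    simp only [Path.Homotopy.reflTransSymmAux]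
    grind
  obtain ⟨K, hK⟩ := key
  obtain ⟨K', hK'⟩ := γ.isLip
  refine ⟨K' * K, fun p q => (hK' _ _).trans ?_⟩
  rw [ENNReal.coe_mul, mul_assoc]
  exact mul_le_mul_right (hK p q) _

theorem symm_trans (γ : LipPath x y) : LipHomotopic (γ.symm.trans γ) (LipPath.refl y) := by
  obtain ⟨H, hH⟩ := trans_symm γ.symm
  exact ⟨H.cast (by simp [LipPath.symm, LipPath.trans]) rfl, hH⟩

end LipHomotopic

/-! ### The Lipschitz homotopy groupoid -/

/-- Lipschitz paths from `x` to `y` modulo Lipschitz homotopy. -/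
def LipClass {P : Type*} [MetricSpace P] (x y : P) : Type _ :=
  Quotient (⟨LipHomotopic, LipHomotopic.equivalence⟩ : Setoid (LipPath x y))

/-- The Lipschitz homotopy groupoid of `P`: its objects are the points of `P`. -/
structure LipGroupoid (P : Type*) where
  /-- the underlying point -/
  pt : P

/-- Morphisms `x ⟶ y` are classes of Lipschitz paths with source `x` and range `y`, and
`[γ] ≫ [γ']` is the class of `γ` followed by `γ'`. -/
instance {P : Type*} [MetricSpace P] : CategoryTheory.Groupoid (LipGroupoid P) where
  Hom x y := LipClass x.pt y.pt
  id x := Quotient.mk _ (LipPath.refl x.pt)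
  comp := Quotient.map₂ LipPath.trans fun _ _ h _ _ h' => LipHomotopic.hcomp h h'
  inv := Quotient.map LipPath.symm fun _ _ h => LipHomotopic.symm₂ h
  id_comp := by rintro _ _ ⟨γ⟩; exact Quotient.sound (LipHomotopic.refl_trans γ)
  comp_id := by rintro _ _ ⟨γ⟩; exact Quotient.sound (LipHomotopic.trans_refl γ)
  assoc := by
    rintro _ _ _ _ ⟨γ⟩ ⟨γ'⟩ ⟨γ''⟩; exact Quotient.sound (LipHomotopic.trans_assoc γ γ' γ'')
  inv_comp := by rintro _ _ ⟨γ⟩; exact Quotient.sound (LipHomotopic.symm_trans γ)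
  comp_inv := by rintro _ _ ⟨γ⟩; exact Quotient.sound (LipHomotopic.trans_symm γ)

/-- The class of a Lipschitz path in the Lipschitz homotopy groupoid. -/
def LipPath.cls {P : Type*} [MetricSpace P] {x y : P} (γ : LipPath x y) :
    (LipGroupoid.mk x) ⟶ (LipGroupoid.mk y) :=
  Quotient.mk _ γ

/-! ### Groupoid actions -/

/-- A continuous (left) action of a groupoid `G` on a family of topological spaces indexed by
the objects of `G`. As `f ≫ g` is "first `f`, then `g`", the left action law reads
`map (f ≫ g) = map g ∘ map f`. -/
structure ContinuousAction (G : Type*) [CategoryTheory.Groupoid G] (E : G → Type*)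
    [∀ x, TopologicalSpace (E x)] where
  /-- the map given by a morphism -/
  map : ∀ {x y : G}, (x ⟶ y) → C(E x, E y)
  map_id : ∀ x : G, map (CategoryTheory.CategoryStruct.id x) = ContinuousMap.id (E x)
  map_comp : ∀ {x y z : G} (f : x ⟶ y) (g : y ⟶ z),
    map (CategoryTheory.CategoryStruct.comp f g) = (map g).comp (map f)

section Approximate

variable {P : Type*} [MetricSpace P] {M : P → Type*} [∀ x, EMetricSpace (M x)]

/-- A strongly approximate action `(μ x y : M y → M x)` of the pair groupoid `P × P`, with
Lipschitz parameter `L`, exponents `a i + b i = 2 + ε` and constants `C i`. -/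
structure IsStronglyApproximateAction (μ : ∀ x y : P, C(M y, M x)) (L ε : ℝ) {n : ℕ}
    (C a b : Fin n → ℝ) : Prop where
  L_nonneg : 0 ≤ L
  ε_pos : 0 < ε
  C_nonneg : ∀ i, 0 ≤ C i
  a_pos : ∀ i, 0 < a i
  b_pos : ∀ i, 0 < b i
  exponents : ∀ i, a i + b i = 2 + ε
  unit : ∀ x, μ x x = ContinuousMap.id (M x)
  lip_le : ∀ x y, lipConst (μ x y) ≤ ENNReal.ofReal (1 + L * dist x y)
  four_point : ∀ x u v y : P,
    supDist ((μ x u).comp (μ u y)) ((μ x v).comp (μ v y)) ≤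
      ENNReal.ofReal
        ((1 + L * dist u x) * ∑ i, C i * dist y v ^ a i * dist u v ^ b i
          + ∑ i, C i * dist x u ^ b i * dist u v ^ a i)

/-- `composite μ x [x₁, …, xₖ₋₁] y` is `μ x x₁ ∘ μ x₁ x₂ ∘ ⋯ ∘ μ xₖ₋₁ y`. -/
def composite (μ : ∀ x y : P, C(M y, M x)) (x : P) : List P → ∀ y : P, C(M y, M x)
  | [], y => μ x y
  | u :: l, y => (μ x u).comp (composite μ u l y)

end Approximate

/-- `(s, t₁, …, tₖ₋₁, t)`, with `l = [t₁, …, tₖ₋₁]`, is a subdivision of the interval between `s`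
and `t`, in increasing or decreasing order. -/
def IsSubdivision (s : I) (l : List I) (t : I) : Prop :=
  (s :: l ++ [t]).Pairwise (· ≤ ·) ∨ (s :: l ++ [t]).Pairwise (· ≥ ·)

/-- The mesh of the subdivision `(s, t₁, …, tₖ₋₁, t)`. -/
def mesh (s : I) : List I → I → ℝ
  | [], t => |(t : ℝ) - s|
  | u :: l, t => max |(u : ℝ) - s| (mesh u l t)

end Knitting

end

open Knitting

noncomputable section

namespace Knitting

open Filter Topology

/-! ### Uniform distances and Lipschitz constants -/

section SupDist

variable {X Y Z : Type*}

/-! Transport along a Lipschitz path is the limit of the compositions of `μ` over the dyadic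
subdivisions of the path. For points at mutual distances of order `r`, the four point inequality
makes the defects of multiplicativity `O(r ^ (2 + ε))`. The bound `1 + L r ≤ exp (L r)` makes the
Lipschitz constants of all compositions along a path bounded uniformly in the number of factors, so
that local defects essentially add up.

The bookkeeping is done by `halving_bound`: if a defect on an interval is at most the sum of the
defects of its halves, up to an exponential Lipschitz factor, then it is at most the number of
pieces times the defect of one piece. Inserting midpoints at level `k` costs `2 ^ k` triangles of
size `2 ^ (-k)`, which is summable in `k`; hence the limit exists and stays close to `μ`.

Homotopy invariance is where an exponent greater than `2` is essential: a Lipschitz homotopy is cut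
into `4 ^ k` squares of side `2 ^ (-k)`, each commuting up to `O(2 ^ (-k (2 + ε)))`, so the total
error is `O(2 ^ (-k ε))`. The transport thus descends to the groupoid, and multiplicativity holds
because halving a concatenation separates its two paths.

Once the action is known to be `O(h ^ (1 + ε))`-close to `μ` on subpaths, uniqueness and convergence
along arbitrary subdivisions need only an exponent greater than `1`: a sum of `h ^ (1 + ε)` over
pieces of total length at most `1` tends to zero with the mesh. -/

theorem supDist_le_iff [TopologicalSpace X] [EMetricSpace Y] {f g : C(X, Y)} {c : ℝ≥0∞} :
    supDist f g ≤ c ↔ ∀ z, edist (f z) (g z) ≤ c := iSup_le_iff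

theorem edist_le_supDist [TopologicalSpace X] [EMetricSpace Y] (f g : C(X, Y)) (z : X) :
    edist (f z) (g z) ≤ supDist f g := le_iSup (fun z => edist (f z) (g z)) z

theorem supDist_comm [TopologicalSpace X] [EMetricSpace Y] (f g : C(X, Y)) :
    supDist f g = supDist g f := by
  simp only [supDist, edist_comm]

theorem supDist_triangle [TopologicalSpace X] [EMetricSpace Y] (f g h : C(X, Y)) :
    supDist f h ≤ supDist f g + supDist g h :=
  supDist_le_iff.2 fun z => (edist_triangle _ (g z) _).trans
    (add_le_add (edist_le_supDist f g z) (edist_le_supDist g h z))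

theorem eq_of_supDist_eq_zero [TopologicalSpace X] [EMetricSpace Y] {f g : C(X, Y)}
    (h : supDist f g = 0) : f = g :=
  ContinuousMap.ext fun z => edist_eq_zero.1 (le_antisymm (h ▸ edist_le_supDist f g z) bot_le)

theorem supDist_comp_right_le [TopologicalSpace X] [TopologicalSpace Y] [EMetricSpace Z]
    (f g : C(Y, Z)) (h : C(X, Y)) : supDist (f.comp h) (g.comp h) ≤ supDist f g :=
  supDist_le_iff.2 fun z => edist_le_supDist f g (h z)

theorem supDist_comp_left_le [TopologicalSpace X] [EMetricSpace Y] [EMetricSpace Z] {K : ℝ≥0}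
    {f : C(Y, Z)} (hf : LipschitzWith K f) (g h : C(X, Y)) :
    supDist (f.comp g) (f.comp h) ≤ K * supDist g h :=
  supDist_le_iff.2 fun z => (hf _ _).trans (by gcongr; exact edist_le_supDist g h z)

theorem supDist_comp_le [TopologicalSpace X] [EMetricSpace Y] [EMetricSpace Z] {K : ℝ≥0}
    {f f' : C(Y, Z)} (hf' : LipschitzWith K f') (g g' : C(X, Y)) :
    supDist (f.comp g) (f'.comp g') ≤ supDist f f' + K * supDist g g' :=
  (supDist_triangle _ (f'.comp g) _).trans
    (add_le_add (supDist_comp_right_le _ _ _) (supDist_comp_left_le hf' _ _))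

theorem lipConst_le_of_lipschitzWith [EMetricSpace X] [EMetricSpace Y] {f : X → Y} {K : ℝ≥0}
    (hf : LipschitzWith K f) : lipConst f ≤ K :=
  iSup_le fun z => iSup_le fun w => iSup_le fun _ => ENNReal.div_le_of_le_mul (hf z w)

theorem edist_div_edist_le_lipConst [EMetricSpace X] [EMetricSpace Y] (f : X → Y) {z w : X}
    (hzw : z ≠ w) : edist (f z) (f w) / edist z w ≤ lipConst f :=
  le_iSup_of_le z (le_iSup_of_le w (le_iSup (fun _ : z ≠ w => edist (f z) (f w) / edist z w) hzw))

/-- The condition `K ≠ 0` takes care of pairs at infinite distance: they contribute nothing to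
`lipConst`, and their Lipschitz inequality is trivial only if `K * ⊤ = ⊤`. -/
theorem lipschitzWith_of_lipConst_le [EMetricSpace X] [EMetricSpace Y] {f : X → Y} {K : ℝ≥0}
    (hK : K ≠ 0) (hf : lipConst f ≤ K) : LipschitzWith K f := by
  intro z w
  rcases eq_or_ne z w with rfl | hzw
  · simp
  by_cases htop : edist z w = ⊤
  · rw [htop, ENNReal.mul_top (by simpa using hK)]
    exact le_top
  · have h : edist (f z) (f w) / edist z w ≤ K :=
      (edist_div_edist_le_lipConst f hzw).trans hf
    rwa [ENNReal.div_le_iff (by simpa using hzw) htop] at h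

end SupDist

namespace LipPath

variable {P : Type*} [MetricSpace P] {x y : P}

theorem lip_nonneg (γ : LipPath x y) : 0 ≤ γ.lip := ENNReal.toReal_nonneg

theorem lip_le (γ : LipPath x y) {K : ℝ} (hK : 0 ≤ K)
    (h : ∀ s t : I, dist (γ s) (γ t) ≤ K * |(s : ℝ) - t|) : γ.lip ≤ K := by
  have h' : LipschitzWith K.toNNReal γ := LipschitzWith.of_dist_le' fun s t => h s t
  exact ENNReal.toReal_le_of_le_ofReal hK (lipConst_le_of_lipschitzWith h')

theorem dist_le (γ : LipPath x y) (s t : I) : dist (γ s) (γ t) ≤ γ.lip * |(s : ℝ) - t| := by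
  obtain ⟨K, hK⟩ := γ.isLip
  -- Finiteness ensures that `toReal` in `lip` does not collapse an infinite constant to `0`.
  have htop : lipConst γ ≠ ⊤ := ne_top_of_le_ne_top ENNReal.coe_ne_top
    (lipConst_le_of_lipschitzWith hK)
  rcases eq_or_ne s t with rfl | hst
  · simp
  have h : edist (γ s) (γ t) / edist s t ≤ lipConst γ :=
    edist_div_edist_le_lipConst γ hst
  rw [ENNReal.div_le_iff (by simpa using hst) (edist_ne_top _ _)] at h
  have h' := ENNReal.toReal_mono (ENNReal.mul_ne_top htop (edist_ne_top _ _)) h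
  rwa [ENNReal.toReal_mul, ← dist_edist, ← dist_edist] at h'

theorem lip_subpath_le (γ : LipPath x y) (s t : I) :
    (γ.subpath t s).lip ≤ γ.lip * |(t : ℝ) - s| := by
  refine lip_le _ (mul_nonneg γ.lip_nonneg (abs_nonneg _)) fun a b => ?_
  refine (γ.dist_le (Set.Icc.convexComb t s a) (Set.Icc.convexComb t s b)).trans (le_of_eq ?_)
  rw [mul_assoc, ← abs_mul, Set.Icc.coe_convexComb, Set.Icc.coe_convexComb, ← abs_neg]
  ring_nf

end LipPath

/-! ### Midpoints and the halving estimate -/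

/-- The midpoint of two points of the unit interval. -/
def mid (s t : I) : I :=
  ⟨((s : ℝ) + t) / 2, by linarith [s.2.1, t.2.1], by linarith [s.2.2, t.2.2]⟩

theorem coe_mid (s t : I) : (mid s t : ℝ) = ((s : ℝ) + t) / 2 := rfl

theorem abs_sub_mid (s t : I) : |(s : ℝ) - mid s t| = |(s : ℝ) - t| / 2 := by
  rw [coe_mid, ← abs_two, ← abs_div, abs_two]
  ring_nf

theorem abs_mid_sub (s t : I) : |(mid s t : ℝ) - t| = |(s : ℝ) - t| / 2 := by
  rw [coe_mid, ← abs_two, ← abs_div, abs_two]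
  ring_nf

theorem abs_sub_le_one (s t : I) : |(s : ℝ) - t| ≤ 1 :=
  abs_le.2 ⟨by linarith [s.2.1, t.2.2], by linarith [s.2.2, t.2.1]⟩

/-- A defect that at each step is controlled by the previous defects of the two halves of an
interval is at most `2 ^ n` times the initial defect at scale `2 ^ (-n)`. -/
theorem halving_bound {δ : ℕ → I → I → ℝ≥0∞} {ℓ : ℝ} (hℓ : 0 ≤ ℓ) {f : ℝ → ℝ}
    (hf : ∀ h, 0 ≤ h → 0 ≤ f h) (h₀ : ∀ s t : I, δ 0 s t ≤ ENNReal.ofReal (f |(s : ℝ) - t|))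
    (hδ : ∀ n s t, δ (n + 1) s t ≤ δ n s (mid s t)
      + ENNReal.ofReal (Real.exp (ℓ * |(s : ℝ) - mid s t|)) * δ n (mid s t) t) (n : ℕ) (s t : I) :
    δ n s t ≤ ENNReal.ofReal
      (Real.exp (ℓ * |(s : ℝ) - t|) * (2 ^ n * f (|(s : ℝ) - t| / 2 ^ n))) := by
  induction n generalizing s t with
  | zero =>
    refine (h₀ s t).trans (ENNReal.ofReal_le_ofReal ?_)
    rw [pow_zero, one_mul, div_one]
    exact le_mul_of_one_le_left (hf _ (abs_nonneg _)) (Real.one_le_exp (by positivity))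
  | succ n ih =>
    refine (hδ n s t).trans ?_
    have i₁ := ih s (mid s t)
    have i₂ := ih (mid s t) t
    rw [abs_sub_mid] at i₁ ⊢
    rw [abs_mid_sub] at i₂
    set h := |(s : ℝ) - t|
    have hh : 0 ≤ h := abs_nonneg _
    have e : h / 2 / 2 ^ n = h / 2 ^ (n + 1) := by rw [pow_succ]; field_simp
    rw [e] at i₁ i₂
    have hF : 0 ≤ 2 ^ n * f (h / 2 ^ (n + 1)) := mul_nonneg (by positivity) (hf _ (by positivity))
    set F := 2 ^ n * f (h / 2 ^ (n + 1))
    have hexp : Real.exp (ℓ * h) = Real.exp (ℓ * (h / 2)) * Real.exp (ℓ * (h / 2)) := by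
      rw [← Real.exp_add]; ring_nf
    have h1 : 1 ≤ Real.exp (ℓ * (h / 2)) := Real.one_le_exp (by positivity)
    -- The factor on the right half multiplies its own exponential to exactly `exp (ℓ h)`, and the
    -- left half is below that too; the exponential therefore does not grow with the number of
    -- halvings.
    calc _ ≤ ENNReal.ofReal (Real.exp (ℓ * (h / 2)) * F)
          + ENNReal.ofReal (Real.exp (ℓ * (h / 2))) * ENNReal.ofReal (Real.exp (ℓ * (h / 2)) * F) := by
            gcongr
      _ = ENNReal.ofReal (Real.exp (ℓ * (h / 2)) * F
          + Real.exp (ℓ * (h / 2)) * (Real.exp (ℓ * (h / 2)) * F)) := by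
            rw [ENNReal.ofReal_add (by positivity) (by positivity),
              ENNReal.ofReal_mul (p := Real.exp (ℓ * (h / 2)))
                (q := Real.exp (ℓ * (h / 2)) * F) (by positivity)]
      _ ≤ _ := by
            apply ENNReal.ofReal_le_ofReal
            have e2 : (2 : ℝ) ^ (n + 1) * f (h / 2 ^ (n + 1)) = 2 * F := by
              simp only [F, pow_succ]; ring
            rw [e2, hexp]
            have := mul_le_mul_of_nonneg_right h1
              (by positivity : 0 ≤ Real.exp (ℓ * (h / 2)) * F)
            linarith

/-! ### Dyadic compositions -/

section Dyadic

variable {P : Type*} {M : P → Type*} [∀ x, TopologicalSpace (M x)]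

/-- The composition of `2 ^ n` maps `μ` along the dyadic subdivision of the interval between `s`
and `t`, with inner points on `p` and endpoints `y` and `x`. -/
def dyadic (μ : ∀ x y : P, C(M y, M x)) (p : I → P) : ℕ → I → I → ∀ y x : P, C(M x, M y)
  | 0, _, _, y, x => μ y x
  | n + 1, s, t, y, x => (dyadic μ p n s (mid s t) y (p (mid s t))).comp
      (dyadic μ p n (mid s t) t (p (mid s t)) x)

theorem dyadic_reparam (μ : ∀ x y : P, C(M y, M x)) {p p' : I → P} (f : I → I)
    (hp : ∀ t, p' t = p (f t)) (hf : ∀ s t, f (mid s t) = mid (f s) (f t)) (n : ℕ) (s t : I)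
    (y x : P) : dyadic μ p' n s t y x = dyadic μ p n (f s) (f t) y x := by
  induction n generalizing s t y x with
  | zero => rfl
  | succ n ih =>
    simp only [dyadic, ih, hf]
    rw [hp, hf]

theorem dyadic_const {μ : ∀ x y : P, C(M y, M x)} {x : P} (hμ : μ x x = ContinuousMap.id (M x))
    (n : ℕ) (s t : I) : dyadic μ (fun _ => x) n s t x x = ContinuousMap.id (M x) := by
  induction n generalizing s t with
  | zero => exact hμ
  | succ n ih => simp only [dyadic, ih, ContinuousMap.id_comp]

end Dyadic

/-! ### Convergence and homotopy estimates for dyadic compositions -/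

namespace IsStronglyApproximateAction

variable {P : Type*} [MetricSpace P] {M : P → Type*} [∀ x, EMetricSpace (M x)]
  {μ : ∀ x y : P, C(M y, M x)} {L ε : ℝ} {n : ℕ} {C a b : Fin n → ℝ}

theorem sum_nonneg (hμ : IsStronglyApproximateAction μ L ε C a b) : 0 ≤ ∑ i, C i :=
  Finset.sum_nonneg fun i _ => hμ.C_nonneg i

theorem lipschitzWith (hμ : IsStronglyApproximateAction μ L ε C a b) {x y : P} {r : ℝ}
    (h : dist x y ≤ r) : LipschitzWith (Real.exp (L * r)).toNNReal (μ x y) := by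
  refine lipschitzWith_of_lipConst_le (by simpa using Real.exp_pos _) ((hμ.lip_le x y).trans ?_)
  refine ENNReal.ofReal_le_ofReal ?_
  have := mul_le_mul_of_nonneg_left h hμ.L_nonneg
  linarith [Real.add_one_le_exp (L * r)]

theorem sum_rpow_le (hμ : IsStronglyApproximateAction μ L ε C a b) {c d : Fin n → ℝ}
    (hc : ∀ i, 0 < c i) (hd : ∀ i, 0 < d i) (hcd : ∀ i, c i + d i = 2 + ε) {p q r : ℝ}
    (hp : 0 ≤ p) (hq : 0 ≤ q) (hpr : p ≤ r) (hqr : q ≤ r) :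
    ∑ i, C i * p ^ c i * q ^ d i ≤ (∑ i, C i) * r ^ (2 + ε) := by
  rw [Finset.sum_mul]
  refine Finset.sum_le_sum fun i _ => ?_
  rw [← hcd i, Real.rpow_add_of_nonneg (hp.trans hpr) (hc i).le (hd i).le, mul_assoc]
  have := hμ.C_nonneg i
  have := (hc i).le
  have := (hd i).le
  have := hp.trans hpr
  gcongr

/-- The four point inequality for points at mutual distances at most `r`. -/
theorem supDist_square_le (hμ : IsStronglyApproximateAction μ L ε C a b) {x u v y : P} {r : ℝ}
    (hxu : dist x u ≤ r) (huv : dist u v ≤ r) (hyv : dist y v ≤ r) :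
    supDist ((μ x u).comp (μ u y)) ((μ x v).comp (μ v y)) ≤
      ENNReal.ofReal ((2 + L * r) * ((∑ i, C i) * r ^ (2 + ε))) := by
  refine (hμ.four_point x u v y).trans (ENNReal.ofReal_le_ofReal ?_)
  have h₁ := hμ.sum_rpow_le hμ.a_pos hμ.b_pos hμ.exponents dist_nonneg dist_nonneg hyv huv
  have h₂ := hμ.sum_rpow_le hμ.b_pos hμ.a_pos (fun i => by rw [add_comm, hμ.exponents])
    dist_nonneg dist_nonneg hxu huv
  rw [dist_comm u x]
  have hL := hμ.L_nonneg
  have hS := hμ.sum_nonneg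
  have hr : 0 ≤ r := dist_nonneg.trans hxu
  have h₃ : (1 + L * dist x u) * ∑ i, C i * dist y v ^ a i * dist u v ^ b i ≤
      (1 + L * r) * ((∑ i, C i) * r ^ (2 + ε)) := by
    refine mul_le_mul (by gcongr) h₁ (Finset.sum_nonneg fun i _ => ?_) (by positivity)
    have := hμ.C_nonneg i
    positivity
  linarith

/-- This is the four point inequality with `v = y`: the first sum vanishes because `dist y v = 0`
and `a i > 0`. -/
theorem supDist_triangle_le (hμ : IsStronglyApproximateAction μ L ε C a b) {x u y : P} {r : ℝ}
    (hxu : dist x u ≤ r) (huy : dist u y ≤ r) :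
    supDist ((μ x u).comp (μ u y)) (μ x y) ≤ ENNReal.ofReal ((∑ i, C i) * r ^ (2 + ε)) := by
  have h := hμ.four_point x u y y
  rw [hμ.unit, ContinuousMap.comp_id] at h
  refine h.trans (ENNReal.ofReal_le_ofReal ?_)
  have h₀ : ∑ i, C i * dist y y ^ a i * dist u y ^ b i = 0 :=
    Finset.sum_eq_zero fun i _ => by rw [dist_self, Real.zero_rpow (hμ.a_pos i).ne']; simp
  rw [h₀, mul_zero, zero_add]
  exact hμ.sum_rpow_le hμ.b_pos hμ.a_pos (fun i => by rw [add_comm, hμ.exponents])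
    dist_nonneg dist_nonneg hxu huy

variable {p : I → P} {K : ℝ}

/-- Lipschitz constants multiply while lengths add, so the exponential bound is independent of the
level `k`. -/
theorem dyadic_lipschitzWith (hμ : IsStronglyApproximateAction μ L ε C a b)
    (hp : ∀ s t : I, dist (p s) (p t) ≤ K * |(s : ℝ) - t|) (k : ℕ) (s t : I) :
    LipschitzWith (Real.exp (L * K * |(s : ℝ) - t|)).toNNReal (dyadic μ p k s t (p s) (p t)) := by
  induction k generalizing s t with
  | zero => rw [mul_assoc]; exact hμ.lipschitzWith (hp s t)
  | succ k ih =>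
    have h := (ih s (mid s t)).comp (ih (mid s t) t)
    rw [← Real.toNNReal_mul (Real.exp_pos _).le, ← Real.exp_add, abs_sub_mid, abs_mid_sub,
      ← mul_add, add_halves] at h
    exact h

/-- Two consecutive levels differ by one midpoint inserted in each of `2 ^ k` pieces, and each
insertion is a triangle with sides at most half a piece times `K`. -/
theorem supDist_dyadic_succ_le (hμ : IsStronglyApproximateAction μ L ε C a b) (hK : 0 ≤ K)
    (hp : ∀ s t : I, dist (p s) (p t) ≤ K * |(s : ℝ) - t|) (k : ℕ) (s t : I) :
    supDist (dyadic μ p k s t (p s) (p t)) (dyadic μ p (k + 1) s t (p s) (p t)) ≤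
      ENNReal.ofReal (Real.exp (L * K * |(s : ℝ) - t|) *
        (2 ^ k * ((∑ i, C i) * (K * (|(s : ℝ) - t| / 2 ^ k / 2)) ^ (2 + ε)))) := by
  have hS := hμ.sum_nonneg
  refine halving_bound
    (δ := fun k s t =>
      supDist (dyadic μ p k s t (p s) (p t)) (dyadic μ p (k + 1) s t (p s) (p t)))
    (f := fun h => (∑ i, C i) * (K * (h / 2)) ^ (2 + ε))
    (mul_nonneg hμ.L_nonneg hK) (fun h hh => by positivity) (fun s t => ?_) (fun k s t => ?_) k s t
  · rw [supDist_comm]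
    refine hμ.supDist_triangle_le ?_ ?_
    · rw [← abs_sub_mid]; exact hp _ _
    · rw [← abs_mid_sub]; exact hp _ _
  · exact supDist_comp_le (hμ.dyadic_lipschitzWith hp _ _ _) _ _

theorem edist_dyadic_succ_le (hμ : IsStronglyApproximateAction μ L ε C a b) (hK : 0 ≤ K)
    (hp : ∀ s t : I, dist (p s) (p t) ≤ K * |(s : ℝ) - t|) {y x : P} (hy : p 1 = y) (hx : p 0 = x)
    (z : M x) (k : ℕ) :
    edist (dyadic μ p k 1 0 y x z) (dyadic μ p (k + 1) 1 0 y x z) ≤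
      ENNReal.ofReal (Real.exp (L * K) * ((∑ i, C i) * K ^ (2 + ε))) / 2 ^ k := by
  subst hy hx
  refine (edist_le_supDist _ _ z).trans ((hμ.supDist_dyadic_succ_le hK hp k 1 0).trans ?_)
  have e : (2 : ℝ≥0∞) ^ k = ENNReal.ofReal (2 ^ k) := by
    rw [ENNReal.ofReal_pow zero_le_two, ENNReal.ofReal_ofNat]
  rw [e, ← ENNReal.ofReal_div_of_pos (by positivity)]
  refine ENNReal.ofReal_le_ofReal ?_
  have hS := hμ.sum_nonneg
  have h₁ : |((1 : I) : ℝ) - (0 : I)| = 1 := by simp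
  -- Weakening the exponent to `2` gives the decay `2 ^ k * 4 ^ (-k) = 2 ^ (-k)`. Summing from level
  -- `0`, which is `μ` itself, then gives the factor `2` in the distance of the limit to `μ`.
  have h₂ : ((1 : ℝ) / 2 ^ k / 2) ^ (2 + ε) ≤ (1 / 2 ^ k) ^ 2 := by
    rw [← Real.rpow_two]
    refine (Real.rpow_le_rpow_of_exponent_ge (z := 2) (by positivity) ?_
      (by linarith [hμ.ε_pos])).trans ?_
    · rw [div_div, ← pow_succ]
      exact div_le_one_of_le₀ (one_le_pow₀ one_le_two) (by positivity)
    · refine Real.rpow_le_rpow (by positivity) ?_ zero_le_two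
      exact half_le_self (by positivity)
  rw [h₁, mul_one, Real.mul_rpow hK (by positivity)]
  calc _ ≤ Real.exp (L * K) * (2 ^ k * ((∑ i, C i) * (K ^ (2 + ε) * (1 / 2 ^ k) ^ 2))) := by
        gcongr
    _ = _ := by field_simp

/-- The transport along a Lipschitz path, the limit of the dyadic compositions. -/
theorem exists_tendsto_dyadic [∀ x, CompleteSpace (M x)]
    (hμ : IsStronglyApproximateAction μ L ε C a b) (hK : 0 ≤ K)
    (hp : ∀ s t : I, dist (p s) (p t) ≤ K * |(s : ℝ) - t|) {y x : P} (hy : p 1 = y)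
    (hx : p 0 = x) : ∃ F : C(M x, M y),
      (∀ z, Tendsto (fun k => dyadic μ p k 1 0 y x z) atTop (𝓝 (F z))) ∧
      LipschitzWith (Real.exp (L * K)).toNNReal F ∧
      supDist F (μ y x) ≤
        ENNReal.ofReal (2 * (Real.exp (L * K) * ((∑ i, C i) * K ^ (2 + ε)))) := by
  have hB := hμ.edist_dyadic_succ_le hK hp hy hx
  have hlim : ∀ z, ∃ w, Tendsto (fun k => dyadic μ p k 1 0 y x z) atTop (𝓝 w) := fun z =>
    cauchySeq_tendsto_of_complete
      (cauchySeq_of_edist_le_geometric_two _ ENNReal.ofReal_ne_top (hB z))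
  choose F hF using hlim
  have hlip : ∀ k, LipschitzWith (Real.exp (L * K)).toNNReal (dyadic μ p k 1 0 y x) := by
    intro k
    subst hy hx
    simpa using hμ.dyadic_lipschitzWith hp k 1 0
  have hFlip : LipschitzWith (Real.exp (L * K)).toNNReal F := fun z w =>
    le_of_tendsto ((hF z).edist (hF w)) (Eventually.of_forall fun k => hlip k z w)
  refine ⟨⟨F, hFlip.continuous⟩, hF, hFlip, ?_⟩
  rw [supDist_comm]
  refine supDist_le_iff.2 fun z => ?_
  rw [ENNReal.ofReal_mul zero_le_two, ENNReal.ofReal_ofNat]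
  exact edist_le_of_edist_le_geometric_two_of_tendsto₀ _ (hB z) (hF z)

/-- Passing from the dyadic composition along one edge of a strip to the one along the
opposite edge. -/
theorem supDist_dyadic_strip_le (hμ : IsStronglyApproximateAction μ L ε C a b) (hK : 0 ≤ K)
    {q : I → I → P}
    (hq : ∀ c c' s t : I, dist (q c s) (q c' t) ≤ K * (|(c : ℝ) - c'| + |(s : ℝ) - t|))
    (c c' : I) (k : ℕ) (s t : I) :
    supDist ((μ (q c' s) (q c s)).comp (dyadic μ (q c) k s t (q c s) (q c t)))
        ((dyadic μ (q c') k s t (q c' s) (q c' t)).comp (μ (q c' t) (q c t))) ≤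
      ENNReal.ofReal (Real.exp (L * K * |(s : ℝ) - t|) * (2 ^ k *
        ((2 + L * (K * (|(c : ℝ) - c'| + |(s : ℝ) - t| / 2 ^ k))) *
          ((∑ i, C i) * (K * (|(c : ℝ) - c'| + |(s : ℝ) - t| / 2 ^ k)) ^ (2 + ε))))) := by
  have hS := hμ.sum_nonneg
  have hL := hμ.L_nonneg
  refine halving_bound
    (δ := fun k s t => supDist ((μ (q c' s) (q c s)).comp (dyadic μ (q c) k s t (q c s) (q c t)))
        ((dyadic μ (q c') k s t (q c' s) (q c' t)).comp (μ (q c' t) (q c t))))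
    (f := fun h => (2 + L * (K * (|(c : ℝ) - c'| + h))) *
          ((∑ i, C i) * (K * (|(c : ℝ) - c'| + h)) ^ (2 + ε)))
    (mul_nonneg hL hK) (fun h hh => by positivity) (fun s t => ?_) (fun k s t => ?_) k s t
  · have hc := abs_nonneg ((c : ℝ) - c')
    have hs := abs_nonneg ((s : ℝ) - t)
    refine hμ.supDist_square_le ?_ (hq _ _ _ _) ?_
    · rw [dist_comm]
      refine (hq c c' s s).trans (mul_le_mul_of_nonneg_left ?_ hK)
      simp
    · refine (hq c c' t t).trans (mul_le_mul_of_nonneg_left ?_ hK)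
      simp
  · set m := mid s t
    -- The intermediate map crosses the strip at the midpoint `m`: one half of the strip is commuted
    -- before it, the other half after it.
    refine (supDist_triangle _ (((dyadic μ (q c') k s m (q c' s) (q c' m)).comp
      (μ (q c' m) (q c m))).comp (dyadic μ (q c) k m t (q c m) (q c t))) _).trans (add_le_add ?_ ?_)
    · exact supDist_comp_right_le _ _ (dyadic μ (q c) k m t (q c m) (q c t))
    · refine supDist_comp_left_le (hμ.dyadic_lipschitzWith (p := q c') (fun s t => ?_) k s m) _ _
      have h := hq c' c' s t
      simpa using h

/-- Dyadic compositions along two edges of a Lipschitz homotopy approach each other. -/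
theorem supDist_dyadic_homotopy_le (hμ : IsStronglyApproximateAction μ L ε C a b) (hK : 0 ≤ K)
    {q : I → I → P}
    (hq : ∀ c c' s t : I, dist (q c s) (q c' t) ≤ K * (|(c : ℝ) - c'| + |(s : ℝ) - t|))
    {y x : P} (hy : ∀ c, q c 1 = y) (hx : ∀ c, q c 0 = x) (k : ℕ) :
    supDist (dyadic μ (q 0) k 1 0 y x) (dyadic μ (q 1) k 1 0 y x) ≤
      ENNReal.ofReal (Real.exp (L * K) * ((2 + L * (K * 2)) * ((∑ i, C i) * (K * 2) ^ (2 + ε)))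
        * ((2 : ℝ) ^ (-ε)) ^ k) := by
  have hS := hμ.sum_nonneg
  have hL := hμ.L_nonneg
  have hstrip : ∀ c c' : I, supDist (dyadic μ (q c) k 1 0 y x) (dyadic μ (q c') k 1 0 y x) ≤
      ENNReal.ofReal (Real.exp (L * K) * (2 ^ k *
        ((2 + L * (K * (|(c : ℝ) - c'| + 1 / 2 ^ k))) *
          ((∑ i, C i) * (K * (|(c : ℝ) - c'| + 1 / 2 ^ k)) ^ (2 + ε))))) := by
    intro c c'
    have h := hμ.supDist_dyadic_strip_le hK hq c c' k 1 0
    rw [hy c', hy c, hx c, hx c', hμ.unit, hμ.unit, ContinuousMap.id_comp,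
      ContinuousMap.comp_id] at h
    simpa using h
  -- Now the homotopy parameter is halved, `k` times as well, so that the squares have equal sides.
  -- The level of the dyadic compositions stays fixed and the recursion is the plain triangle
  -- inequality, whence `ℓ = 0`.
  have h := halving_bound (ℓ := 0)
    (δ := fun _ c c' => supDist (dyadic μ (q c) k 1 0 y x) (dyadic μ (q c') k 1 0 y x))
    (f := fun h => Real.exp (L * K) * (2 ^ k * ((2 + L * (K * (h + 1 / 2 ^ k))) *
          ((∑ i, C i) * (K * (h + 1 / 2 ^ k)) ^ (2 + ε)))))
    le_rfl (fun h hh => by positivity) hstrip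
    (fun _ c c' => by simpa using supDist_triangle _ _ _) k 0 1
  refine h.trans (ENNReal.ofReal_le_ofReal ?_)
  have h₁ : |((0 : I) : ℝ) - (1 : I)| = 1 := by simp
  have h₂ : K * ((1 : ℝ) / 2 ^ k + 1 / 2 ^ k) = (K * 2) * (1 / 2 ^ k) := by ring
  rw [h₁, zero_mul, Real.exp_zero, one_mul, h₂, Real.mul_rpow (by positivity) (by positivity)]
  have h₃ : ((1 : ℝ) / 2 ^ k) ^ (2 + ε) = (1 / 2 ^ k) ^ 2 * ((2 : ℝ) ^ (-ε)) ^ k := by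
    rw [Real.rpow_add (by positivity), Real.rpow_two, Real.rpow_pow_comm zero_le_two,
      Real.rpow_neg (by positivity), one_div, Real.inv_rpow (by positivity)]
  have h₄ : (K * 2) * ((1 : ℝ) / 2 ^ k) ≤ K * 2 :=
    mul_le_of_le_one_right (by positivity)
      (div_le_one_of_le₀ (one_le_pow₀ one_le_two) (by positivity))
  rw [h₃]
  -- The two factors `2 ^ k` count strips and squares per strip; they cancel `(1 / 2 ^ k) ^ 2`,
  -- leaving the decay due to `ε`.
  calc _ ≤ 2 ^ k * (Real.exp (L * K) * (2 ^ k * ((2 + L * (K * 2)) *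
          ((∑ i, C i) * ((K * 2) ^ (2 + ε) * ((1 / 2 ^ k) ^ 2 * ((2 : ℝ) ^ (-ε)) ^ k)))))) := by
        gcongr
    _ = _ := by field_simp

end IsStronglyApproximateAction

/-! ### The action by transport -/

/-- The first half of the unit interval. -/
def firstHalf (t : I) : I := ⟨(t : ℝ) / 2, by linarith [t.2.1], by linarith [t.2.2]⟩

/-- The second half of the unit interval. -/
def secondHalf (t : I) : I := ⟨((t : ℝ) + 1) / 2, by linarith [t.2.1], by linarith [t.2.2]⟩

theorem firstHalf_zero : firstHalf 0 = 0 := Subtype.ext (by simp [firstHalf])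

theorem firstHalf_one : firstHalf 1 = mid 1 0 := Subtype.ext (by simp [firstHalf, mid])

theorem secondHalf_zero : secondHalf 0 = mid 1 0 := Subtype.ext (by simp [secondHalf, mid])

theorem secondHalf_one : secondHalf 1 = 1 := Subtype.ext (by simp [secondHalf])

theorem firstHalf_mid (s t : I) : firstHalf (mid s t) = mid (firstHalf s) (firstHalf t) :=
  Subtype.ext (by simp only [firstHalf, mid]; ring)

theorem secondHalf_mid (s t : I) : secondHalf (mid s t) = mid (secondHalf s) (secondHalf t) :=
  Subtype.ext (by simp only [secondHalf, mid]; ring)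

namespace LipPath

variable {P : Type*} [MetricSpace P] {x y z : P}

theorem trans_firstHalf (γ : LipPath x y) (γ' : LipPath y z) (t : I) :
    (γ.trans γ') (firstHalf t) = γ t := by
  have h : ((firstHalf t : I) : ℝ) ≤ 1 / 2 := by
    simp only [firstHalf]; linarith [t.2.2]
  refine (Path.trans_apply γ.toPath γ'.toPath _).trans ?_
  rw [dif_pos h]
  congr 1
  exact Subtype.ext (by simp only [firstHalf]; ring)

theorem trans_secondHalf (γ : LipPath x y) (γ' : LipPath y z) (t : I) :
    (γ.trans γ') (secondHalf t) = γ' t := by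
  refine (Path.trans_apply γ.toPath γ'.toPath _).trans ?_
  split_ifs with h
  · have ht : t = 0 := Subtype.ext <| le_antisymm
      (by simp only [secondHalf] at h; simp only [Set.Icc.coe_zero]; linarith) t.2.1
    subst ht
    rw [γ'.toPath.source]
    convert γ.toPath.target using 2
    exact Subtype.ext (by simp [secondHalf])
  · congr 1
    exact Subtype.ext (by simp only [secondHalf]; ring)

end LipPath

/-- The first halving of `[0, 1]` falls on the junction point, which costs one level. The upper half
carries `γ'`, the map applied last. -/
theorem dyadic_trans {P : Type*} [MetricSpace P] {M : P → Type*} [∀ x, TopologicalSpace (M x)]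
    (μ : ∀ x y : P, C(M y, M x)) {x y z : P} (γ : LipPath x y) (γ' : LipPath y z) (n : ℕ) :
    dyadic μ (γ.trans γ') (n + 1) 1 0 z x = (dyadic μ γ' n 1 0 z y).comp (dyadic μ γ n 1 0 y x) := by
  have hm : (γ.trans γ') (mid 1 0) = y := by
    rw [← firstHalf_one, LipPath.trans_firstHalf]
    exact γ.toPath.target
  rw [dyadic_reparam μ secondHalf (fun t => (LipPath.trans_secondHalf γ γ' t).symm) secondHalf_mid,
    dyadic_reparam μ firstHalf (fun t => (LipPath.trans_firstHalf γ γ' t).symm) firstHalf_mid,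
    firstHalf_zero, firstHalf_one, secondHalf_zero, secondHalf_one, dyadic, hm]

namespace IsStronglyApproximateAction

variable {P : Type*} [MetricSpace P] {M : P → Type*} [∀ x, EMetricSpace (M x)]
  {μ : ∀ x y : P, C(M y, M x)} {L ε : ℝ} {n : ℕ} {C a b : Fin n → ℝ}

theorem tendsto_supDist_dyadic_of_lipHomotopic (hμ : IsStronglyApproximateAction μ L ε C a b)
    {x y : P} {γ₀ γ₁ : LipPath x y} (h : LipHomotopic γ₀ γ₁) :
    Tendsto (fun k => supDist (dyadic μ γ₀ k 1 0 y x) (dyadic μ γ₁ k 1 0 y x)) atTop (𝓝 0) := by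
  obtain ⟨H, K, hK⟩ := h
  have hq : ∀ c c' s t : I, dist (H (c, s)) (H (c', t)) ≤ K * (|(c : ℝ) - c'| + |(s : ℝ) - t|) := by
    intro c c' s t
    refine (hK.dist_le_mul _ _).trans (mul_le_mul_of_nonneg_left ?_ K.2)
    exact max_le (le_add_of_nonneg_right (abs_nonneg _)) (le_add_of_nonneg_left (abs_nonneg _))
  have hB := hμ.supDist_dyadic_homotopy_le K.2 (q := fun c s => H (c, s)) hq
    (fun c => H.target c) (fun c => H.source c)
  have e₀ : (fun s => H (0, s)) = γ₀ := funext fun s => H.apply_zero s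
  have e₁ : (fun s => H (1, s)) = γ₁ := funext fun s => H.apply_one s
  rw [e₀, e₁] at hB
  refine tendsto_of_tendsto_of_tendsto_of_le_of_le tendsto_const_nhds ?_ (fun _ => bot_le) hB
  have hε : (2 : ℝ) ^ (-ε) < 1 :=
    Real.rpow_lt_one_of_one_lt_of_neg one_lt_two (neg_lt_zero.2 hμ.ε_pos)
  have := (tendsto_pow_atTop_nhds_zero_of_lt_one (by positivity) hε).const_mul
    (Real.exp (L * K) * ((2 + L * (K * 2)) * ((∑ i, C i) * (K * 2) ^ (2 + ε))))
  rw [mul_zero] at this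
  simpa using ENNReal.tendsto_ofReal this

/-- The transport along Lipschitz paths is a continuous action of the Lipschitz homotopy
groupoid. -/
theorem exists_continuousAction [∀ x, CompleteSpace (M x)]
    (hμ : IsStronglyApproximateAction μ L ε C a b) :
    ∃ φ : ContinuousAction (LipGroupoid P) (fun x => M x.pt), ∀ (x y : P) (γ : LipPath x y),
      LipschitzWith (Real.exp (L * γ.lip)).toNNReal (φ.map γ.cls) ∧
      supDist (φ.map γ.cls) (μ y x) ≤
        ENNReal.ofReal (2 * (Real.exp (L * γ.lip) * ((∑ i, C i) * γ.lip ^ (2 + ε)))) := by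
  have hex := fun (x y : P) (γ : LipPath x y) =>
    hμ.exists_tendsto_dyadic γ.lip_nonneg γ.dist_le γ.toPath.target γ.toPath.source
  choose F hF hlip hdist using hex
  have hhom : ∀ (x y : P) (γ₀ γ₁ : LipPath x y), LipHomotopic γ₀ γ₁ → F x y γ₀ = F x y γ₁ := by
    intro x y γ₀ γ₁ h
    ext z
    have h₁ := (hF x y γ₀ z).edist (hF x y γ₁ z)
    have h₂ := tendsto_of_tendsto_of_tendsto_of_le_of_le tendsto_const_nhds
      (hμ.tendsto_supDist_dyadic_of_lipHomotopic h) (fun _ => bot_le)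
      (fun k => edist_le_supDist (dyadic μ γ₀ k 1 0 y x) (dyadic μ γ₁ k 1 0 y x) z)
    exact edist_eq_zero.1 (tendsto_nhds_unique h₁ h₂)
  have hrefl : ∀ x : P, F x x (LipPath.refl x) = ContinuousMap.id (M x) := by
    intro x
    ext z
    refine tendsto_nhds_unique (hF x x (LipPath.refl x) z) ?_
    have e : ∀ k, dyadic μ (LipPath.refl x) k 1 0 x x = ContinuousMap.id (M x) := fun k =>
      dyadic_const (hμ.unit x) k 1 0
    simp only [e]
    exact tendsto_const_nhds
  have htrans : ∀ (x y z : P) (γ : LipPath x y) (γ' : LipPath y z),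
      F x z (γ.trans γ') = (F y z γ').comp (F x y γ) := by
    intro x y z γ γ'
    ext w
    refine tendsto_nhds_unique ((tendsto_add_atTop_iff_nat 1).2 (hF x z (γ.trans γ') w)) ?_
    simp only [dyadic_trans, ContinuousMap.comp_apply]
    -- A Lipschitz constant independent of `k` is what allows pointwise limits to pass through the
    -- composition.
    have hL : ∀ k, LipschitzWith (Real.exp (L * γ'.lip)).toNNReal (dyadic μ γ' k 1 0 z y) := by
      intro k
      have := hμ.dyadic_lipschitzWith γ'.dist_le k 1 0
      rw [γ'.toPath.source, γ'.toPath.target] at this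
      simpa using this
    have h₁ : Tendsto (fun k => edist (dyadic μ γ k 1 0 y x w) (F x y γ w)) atTop (𝓝 0) :=
      tendsto_iff_edist_tendsto_0.1 (hF x y γ w)
    have h₂ : Tendsto (fun k => edist (dyadic μ γ' k 1 0 z y (F x y γ w)) (F y z γ' (F x y γ w)))
        atTop (𝓝 0) := tendsto_iff_edist_tendsto_0.1 (hF y z γ' (F x y γ w))
    have h₃ := (ENNReal.Tendsto.const_mul (a := ((Real.exp (L * γ'.lip)).toNNReal : ℝ≥0∞)) h₁
      (Or.inr ENNReal.coe_ne_top)).add h₂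
    rw [mul_zero, add_zero] at h₃
    refine tendsto_iff_edist_tendsto_0.2 (tendsto_of_tendsto_of_tendsto_of_le_of_le
      tendsto_const_nhds h₃ (fun _ => bot_le) fun k => ?_)
    exact (edist_triangle _ (dyadic μ γ' k 1 0 z y (F x y γ w)) _).trans
      (add_le_add (hL k _ _) le_rfl)
  refine ⟨⟨fun {x y} f => Quotient.lift (F x.pt y.pt) (hhom x.pt y.pt) f,
    fun x => hrefl x.pt, ?_⟩, fun x y γ => ⟨hlip x y γ, hdist x y γ⟩⟩
  rintro x y z ⟨γ⟩ ⟨γ'⟩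
  exact htrans _ _ _ γ γ'

end IsStronglyApproximateAction

/-! ### Subpaths in the Lipschitz homotopy groupoid -/

section Subpath

variable {P : Type*} [MetricSpace P] {x y : P}

theorem isLip_convexComb {α β : I → I} (hα : IsLip α) (hβ : IsLip β) :
    IsLip fun p : I × I => Set.Icc.convexComb (α p.2) (β p.2) p.1 := by
  have key : IsLip fun p : I × I =>
      ((unitInterval.symm p.1 : I) : ℝ) * (α p.2 : ℝ) + (p.1 : ℝ) * (β p.2 : ℝ) :=
    ((IsLip.coe_I.comp (IsLip.symm_I.comp IsLip.fst)).mul (IsLip.coe_I.comp (hα.comp IsLip.snd))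
      (fun _ => IsLip.abs_I_le _) (fun _ => IsLip.abs_I_le _)).add
    ((IsLip.coe_I.comp IsLip.fst).mul (IsLip.coe_I.comp (hβ.comp IsLip.snd))
      (fun _ => IsLip.abs_I_le _) (fun _ => IsLip.abs_I_le _))
  obtain ⟨K, hK⟩ := key
  refine ⟨K, fun p q => ?_⟩
  have h := hK p q
  simp only [unitInterval.coe_symm_eq] at h
  rw [Subtype.edist_eq, Set.Icc.coe_convexComb, Set.Icc.coe_convexComb]
  exact h

/-- Two Lipschitz reparametrisations of a path with the same ends are Lipschitz homotopic. -/
theorem LipHomotopic.of_reparam (γ : LipPath x y) {v w : P} {ρ τ : LipPath v w} {α β : I → I}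
    (hα : IsLip α) (hβ : IsLip β) (hρ : ∀ u, ρ u = γ (α u)) (hτ : ∀ u, τ u = γ (β u))
    (h₀ : α 0 = β 0) (h₁ : α 1 = β 1) : LipHomotopic ρ τ := by
  have hH := γ.isLip.comp (isLip_convexComb hα hβ)
  refine ⟨⟨⟨⟨fun p => γ (Set.Icc.convexComb (α p.2) (β p.2) p.1), ?_⟩, ?_, ?_⟩, ?_⟩, hH⟩
  · obtain ⟨K, hK⟩ := hH
    exact hK.continuous
  · intro u
    simpa using (hρ u).symm
  · intro u
    simpa using (hτ u).symm
  · rintro c u (rfl | rfl)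
    · have : Set.Icc.convexComb (α 0) (β 0) c = α 0 := by rw [← h₀]; simp
      simpa [this] using (hρ 0).symm
    · have : Set.Icc.convexComb (α 1) (β 1) c = α 1 := by rw [← h₁]; simp
      simpa [this] using (hρ 1).symm

/-- Both sides are `γ` after a path in the parameter interval from `t₀` to `t₂`. These paths are
built by applying the same constructions to the identity path `ι` of `I`, and they are joined by
convex combinations. -/
theorem LipHomotopic.subpath_trans_subpath (γ : LipPath x y) (t₀ t₁ t₂ : I) :
    LipHomotopic ((γ.subpath t₀ t₁).trans (γ.subpath t₁ t₂)) (γ.subpath t₀ t₂) := by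
  let ι : LipPath (0 : I) 1 := ⟨⟨⟨id, continuous_id⟩, rfl, rfl⟩, ⟨1, LipschitzWith.id⟩⟩
  let α := (ι.subpath t₀ t₁).trans (ι.subpath t₁ t₂)
  let β := ι.subpath t₀ t₂
  refine LipHomotopic.of_reparam γ (α := α) (β := β) α.isLip β.isLip (fun u => ?_) (fun u => rfl)
    (α.toPath.source.trans β.toPath.source.symm) (α.toPath.target.trans β.toPath.target.symm)
  refine (Path.trans_apply (γ.subpath t₀ t₁).toPath (γ.subpath t₁ t₂).toPath u).trans
    (Eq.trans ?_ (congrArg γ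
      (Path.trans_apply (ι.subpath t₀ t₁).toPath (ι.subpath t₁ t₂).toPath u).symm))
  split_ifs <;> rfl

theorem ContinuousAction.map_subpath {M : P → Type*} [∀ x, TopologicalSpace (M x)]
    (φ : ContinuousAction (LipGroupoid P) (fun x => M x.pt)) (γ : LipPath x y) (s u t : I) :
    φ.map (γ.subpath t s).cls = (φ.map (γ.subpath u s).cls).comp (φ.map (γ.subpath t u).cls) := by
  rw [← φ.map_comp]
  exact congrArg φ.map (Quotient.sound (LipHomotopic.subpath_trans_subpath γ t u s).symm)

theorem ContinuousAction.eq_of_map_subpath_eq {M : P → Type*} [∀ x, TopologicalSpace (M x)]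
    {φ ψ : ContinuousAction (LipGroupoid P) (fun x => M x.pt)}
    (h : ∀ (x y : P) (γ : LipPath x y) (s t : I),
      ψ.map (γ.subpath t s).cls = φ.map (γ.subpath t s).cls) : ψ = φ := by
  -- The subpath from `0` to `1` has endpoints `γ 0` and `γ 1`, equal to `x` and `y` only
  -- propositionally; freeing the endpoints avoids casts between the spaces.
  have hcls : ∀ (x y x' y' : P) (γ : LipPath x y) (ρ : LipPath x' y'), x' = x → y' = y →
      (∀ u, ρ u = γ u) → ψ.map ρ.cls = φ.map ρ.cls → ψ.map γ.cls = φ.map γ.cls := by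
    rintro x y _ _ ⟨γ, hγ⟩ ⟨ρ, hρ⟩ rfl rfl hu h
    obtain rfl : ρ = γ := Path.ext (funext hu)
    exact h
  have hmap : @ContinuousAction.map _ _ _ _ ψ = @ContinuousAction.map _ _ _ _ φ := by
    funext x y f
    induction f using Quotient.ind with
    | _ γ =>
      refine hcls _ _ _ _ γ (γ.subpath 0 1) γ.toPath.source γ.toPath.target (fun u => ?_)
        (h _ _ γ 1 0)
      change γ (Set.Icc.convexComb 0 1 u) = γ u
      congr 1
      exact Subtype.ext (by simp)
  cases φ
  cases ψ
  cases hmap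
  rfl

end Subpath

/-- The first term of the series is `1` and the others are nonnegative. The main estimate is proved
without the zeta factor, which is then inserted thanks to this bound. -/
theorem one_le_riemannZeta_re {x : ℝ} (hx : 1 < x) : 1 ≤ (riemannZeta (x : ℂ)).re := by
  have hs : Summable fun n : ℕ => 1 / ((n + 1 : ℝ)) ^ x := by
    have := (summable_nat_add_iff 1).2 (Real.summable_one_div_nat_rpow.2 hx)
    simpa using this
  have e : riemannZeta (x : ℂ) = ((∑' n : ℕ, 1 / ((n + 1 : ℝ)) ^ x : ℝ) : ℂ) := by
    rw [zeta_eq_tsum_one_div_nat_add_one_cpow (by simpa using hx), Complex.ofReal_tsum]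
    refine tsum_congr fun n => ?_
    rw [Complex.ofReal_div, Complex.ofReal_cpow (by positivity)]
    simp
  rw [e, Complex.ofReal_re]
  simpa using hs.le_tsum 0 fun n _ => by positivity

/-! ### Subdivisions -/

theorem IsSubdivision.tail {s u t : I} {l : List I} (h : IsSubdivision s (u :: l) t) :
    IsSubdivision u l t :=
  h.imp (fun h => (List.pairwise_cons.1 h).2) (fun h => (List.pairwise_cons.1 h).2)

theorem IsSubdivision.abs_add_abs {s u t : I} {l : List I} (h : IsSubdivision s (u :: l) t) :
    |(u : ℝ) - s| + |(t : ℝ) - u| = |(t : ℝ) - s| := by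
  rcases h with h | h
  · have h₁ : (s : ℝ) ≤ u := (List.pairwise_cons.1 h).1 u (by simp)
    have h₂ : (u : ℝ) ≤ t := (List.pairwise_cons.1 (List.pairwise_cons.1 h).2).1 t (by simp)
    rw [abs_of_nonneg (by linarith), abs_of_nonneg (by linarith), abs_of_nonneg (by linarith)]
    ring
  · have h₁ : (u : ℝ) ≤ s := (List.pairwise_cons.1 h).1 u (by simp)
    have h₂ : (t : ℝ) ≤ u := (List.pairwise_cons.1 (List.pairwise_cons.1 h).2).1 t (by simp)
    rw [abs_of_nonpos (by linarith), abs_of_nonpos (by linarith), abs_of_nonpos (by linarith)]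
    ring

theorem rpow_one_add_le {r m ε : ℝ} (hr : 0 ≤ r) (hε : 0 ≤ ε) (h : r ≤ m) :
    r ^ (1 + ε) ≤ m ^ ε * r := by
  rw [Real.rpow_add_of_nonneg hr zero_le_one hε, Real.rpow_one, mul_comm]
  gcongr

theorem exists_ofReal_mul_rpow_lt {ε : ℝ} (hε : 0 < ε) (c A d : ℝ) {η : ℝ≥0∞} (hη : 0 < η) :
    ∃ δ : ℝ, 0 < δ ∧ ENNReal.ofReal (c * (A * (δ ^ ε * d))) < η := by
  have h : Tendsto (fun m : ℝ => c * (A * (m ^ ε * d))) (𝓝 0) (𝓝 (c * (A * ((0 : ℝ) ^ ε * d)))) :=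
    (((Real.continuousAt_rpow_const 0 ε (Or.inr hε.le)).tendsto.mul_const _).const_mul _).const_mul _
  rw [Real.zero_rpow hε.ne', zero_mul, mul_zero, mul_zero] at h
  have hlim := ENNReal.tendsto_ofReal (h.mono_left (nhdsWithin_le_nhds (s := Set.Ioi 0)))
  rw [ENNReal.ofReal_zero] at hlim
  obtain ⟨δ, hδη, hδ⟩ := ((hlim.eventually_lt_const hη).and self_mem_nhdsWithin).exists
  exact ⟨δ, hδ, hδη⟩

/-! ### Arbitrary subdivisions and uniqueness -/

section Action

variable {P : Type*} [MetricSpace P] {M : P → Type*} [∀ x, EMetricSpace (M x)]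
  {μ : ∀ x y : P, C(M y, M x)} {φ ψ : ContinuousAction (LipGroupoid P) (fun x => M x.pt)}
  {x y : P} {γ : LipPath x y} {A ε ℓ : ℝ}

/-- Peeling off the first piece, of length `r`, costs `A r ^ (1 + ε) ≤ A m ^ ε r`, and by
monotonicity the lengths add up to `|t - s|`. Only the Lipschitz constants of `φ` are used, not
those of `μ`. -/
theorem supDist_composite_le (hA : 0 ≤ A) (hε : 0 ≤ ε) (hℓ : 0 ≤ ℓ)
    (hφ : ∀ s t : I, supDist (φ.map (γ.subpath t s).cls) (μ (γ s) (γ t)) ≤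
      ENNReal.ofReal (A * |(t : ℝ) - s| ^ (1 + ε)))
    (hlip : ∀ s t : I, LipschitzWith (Real.exp (ℓ * |(t : ℝ) - s|)).toNNReal
      (φ.map (γ.subpath t s).cls)) {m : ℝ} (l : List I) (s t : I)
    (hl : IsSubdivision s l t) (hm : mesh s l t ≤ m) :
    supDist (composite μ (γ s) (l.map γ) (γ t)) (φ.map (γ.subpath t s).cls) ≤
      ENNReal.ofReal (Real.exp (ℓ * |(t : ℝ) - s|) * (A * (m ^ ε * |(t : ℝ) - s|))) := by
  induction l generalizing s with
  | nil =>
    have hm' : |(t : ℝ) - s| ≤ m := hm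
    have hm₀ : 0 ≤ m := (abs_nonneg _).trans hm'
    rw [supDist_comm]
    refine (hφ s t).trans (ENNReal.ofReal_le_ofReal ?_)
    calc _ ≤ A * (m ^ ε * |(t : ℝ) - s|) :=
          mul_le_mul_of_nonneg_left (rpow_one_add_le (abs_nonneg _) hε hm') hA
      _ ≤ _ := le_mul_of_one_le_left (by positivity) (Real.one_le_exp (by positivity))
  | cons u l ih =>
    have hm₁ : |(u : ℝ) - s| ≤ m := (le_max_left _ _).trans hm
    have hm₂ : mesh u l t ≤ m := (le_max_right _ _).trans hm
    have hm₀ : 0 ≤ m := (abs_nonneg _).trans hm₁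
    have i := ih u hl.tail hm₂
    have j := hφ s u
    rw [supDist_comm] at j
    rw [φ.map_subpath (M := M) γ s u t, ← hl.abs_add_abs]
    refine (supDist_comp_le (hlip s u) _ _).trans ((add_le_add j (mul_le_mul_right i _)).trans ?_)
    set c := |(u : ℝ) - s|
    set d := |(t : ℝ) - u|
    have hc : 0 ≤ c := abs_nonneg _
    have hd : 0 ≤ d := abs_nonneg _
    change _ + ENNReal.ofReal _ * _ ≤ _
    rw [← ENNReal.ofReal_mul (by positivity), ← ENNReal.ofReal_add (by positivity) (by positivity)]
    refine ENNReal.ofReal_le_ofReal ?_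
    have h₁ : A * c ^ (1 + ε) ≤ Real.exp (ℓ * (c + d)) * (A * (m ^ ε * c)) :=
      (mul_le_mul_of_nonneg_left (rpow_one_add_le hc hε hm₁) hA).trans
        (le_mul_of_one_le_left (by positivity) (Real.one_le_exp (by positivity)))
    have h₂ : Real.exp (ℓ * c) * (Real.exp (ℓ * d) * (A * (m ^ ε * d))) =
        Real.exp (ℓ * (c + d)) * (A * (m ^ ε * d)) := by
      rw [mul_add, Real.exp_add]; ring
    rw [h₂]
    linarith

/-- Two actions that agree to order `1 + ε` along the subpaths of a path agree on them. -/
theorem map_subpath_eq_of_supDist_le (hA : 0 ≤ A) (hε : 0 < ε) (hℓ : 0 ≤ ℓ)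
    (hψ : ∀ s t : I, supDist (ψ.map (γ.subpath t s).cls) (φ.map (γ.subpath t s).cls) ≤
      ENNReal.ofReal (A * |(s : ℝ) - t| ^ (1 + ε)))
    (hlip : ∀ s t : I, LipschitzWith (Real.exp (ℓ * |(s : ℝ) - t|)).toNNReal
      (φ.map (γ.subpath t s).cls)) (s t : I) :
    ψ.map (γ.subpath t s).cls = φ.map (γ.subpath t s).cls := by
  -- Both actions are exactly multiplicative, so the defect does not depend on the level: for every
  -- `k` it is at most a constant times `2 ^ k * 2 ^ (-k (1 + ε))`. Only `φ` has to be Lipschitz.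
  have hB := fun k => halving_bound (f := fun h => A * h ^ (1 + ε))
    (δ := fun _ s t => supDist (ψ.map (γ.subpath t s).cls) (φ.map (γ.subpath t s).cls)) hℓ
    (fun h hh => by positivity) hψ
    (fun _ s t => by
      rw [ψ.map_subpath (M := M) γ s (mid s t) t, φ.map_subpath (M := M) γ s (mid s t) t]
      exact supDist_comp_le (hlip _ _) _ _) k s t
  have hε' : (2 : ℝ) ^ (-ε) < 1 :=
    Real.rpow_lt_one_of_one_lt_of_neg one_lt_two (neg_lt_zero.2 hε)
  have hlim := (tendsto_pow_atTop_nhds_zero_of_lt_one (by positivity) hε').const_mul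
    (Real.exp (ℓ * |(s : ℝ) - t|) * (A * |(s : ℝ) - t| ^ (1 + ε)))
  rw [mul_zero] at hlim
  have hlim' := ENNReal.tendsto_ofReal hlim
  rw [ENNReal.ofReal_zero] at hlim'
  refine eq_of_supDist_eq_zero (le_antisymm (ge_of_tendsto' hlim' fun k => (hB k).trans ?_) bot_le)
  refine ENNReal.ofReal_le_ofReal (le_of_eq ?_)
  have h : ((2 : ℝ) ^ k) ^ (1 + ε) = 2 ^ k * (((2 : ℝ) ^ (-ε)) ^ k)⁻¹ := by
    rw [Real.rpow_add (by positivity), Real.rpow_one, Real.rpow_pow_comm zero_le_two,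
      Real.rpow_neg (by positivity), inv_inv]
  rw [Real.div_rpow (abs_nonneg _) (by positivity), h]
  field_simp

end Action

end Knitting

end

theorem theorem4p9 {P : Type*} [MetricSpace P] (M : P → Type*) [∀ x, EMetricSpace (M x)]
    [∀ x, CompleteSpace (M x)] (μ : ∀ x y : P, C(M y, M x)) (L ε : ℝ) (n : ℕ)
    (C a b : Fin n → ℝ) (hμ : IsStronglyApproximateAction μ L ε C a b) :
    ∃ φ : ContinuousAction (LipGroupoid P) (fun x => M x.pt),
      -- `φ` is close to `μ` along Lipschitz paths, with an explicit constant
      (∀ (x y : P) (γ : LipPath x y) (s t : I),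
        supDist (φ.map (γ.subpath t s).cls) (μ (γ s) (γ t)) ≤
          ENNReal.ofReal
            (2 ^ (1 + ε) * γ.lip ^ (2 + ε) * Real.exp (L * γ.lip * |(t : ℝ) - s|) * (∑ i, C i)
              * (riemannZeta ((2 + ε : ℝ) : ℂ)).re * |(t : ℝ) - s| ^ (1 + ε))) ∧
      -- `φ` is the only continuous action that is close to `μ`, whatever the constants
      (∀ ψ : ContinuousAction (LipGroupoid P) (fun x => M x.pt),
        (∀ (x y : P) (γ : LipPath x y), ∃ C' : ℝ, ∀ s t : I,
          supDist (ψ.map (γ.subpath t s).cls) (μ (γ s) (γ t)) ≤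
            ENNReal.ofReal (C' * |(t : ℝ) - s| ^ (1 + ε))) → ψ = φ) ∧
      -- `φ` is the limit of the compositions of `μ` along subdivisions
      (∀ (x y : P) (γ : LipPath x y) (s t : I) (η : ℝ≥0∞), 0 < η → ∃ δ : ℝ, 0 < δ ∧
        ∀ l : List I, IsSubdivision s l t → mesh s l t < δ →
          supDist (composite μ (γ s) (l.map γ) (γ t)) (φ.map (γ.subpath t s).cls) < η) ∧
      -- Lipschitz bound for `φ`
      (∀ (x y : P) (γ : LipPath x y) (s t : I),
        lipConst (φ.map (γ.subpath t s).cls) ≤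
          ENNReal.ofReal (Real.exp (L * γ.lip * |(t : ℝ) - s|))) := by
  obtain ⟨φ, hφ⟩ := hμ.exists_continuousAction
  have hL := hμ.L_nonneg
  have hε := hμ.ε_pos
  have hS := hμ.sum_nonneg
  have hexp : ∀ (x y : P) (γ : LipPath x y) (s t : I),
      Real.exp (L * (γ.subpath t s).lip) ≤ Real.exp (L * γ.lip * |(t : ℝ) - s|) := by
    intro x y γ s t
    rw [mul_assoc]
    exact Real.exp_le_exp.2 (mul_le_mul_of_nonneg_left (γ.lip_subpath_le s t) hL)
  have hlip : ∀ (x y : P) (γ : LipPath x y) (s t : I),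
      LipschitzWith (Real.exp (L * γ.lip * |(t : ℝ) - s|)).toNNReal
        (φ.map (γ.subpath t s).cls) := fun x y γ s t =>
    (hφ _ _ (γ.subpath t s)).1.weaken (Real.toNNReal_le_toNNReal (hexp x y γ s t))
  have hζ : 1 ≤ (riemannZeta ((2 + ε : ℝ) : ℂ)).re := one_le_riemannZeta_re (by linarith)
  have hclose : ∀ (x y : P) (γ : LipPath x y) (s t : I),
      supDist (φ.map (γ.subpath t s).cls) (μ (γ s) (γ t)) ≤
        ENNReal.ofReal
          (2 ^ (1 + ε) * γ.lip ^ (2 + ε) * Real.exp (L * γ.lip * |(t : ℝ) - s|) * (∑ i, C i)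
            * (riemannZeta ((2 + ε : ℝ) : ℂ)).re * |(t : ℝ) - s| ^ (1 + ε)) := by
    intro x y γ s t
    refine (hφ _ _ (γ.subpath t s)).2.trans (ENNReal.ofReal_le_ofReal ?_)
    have h₀ := γ.lip_nonneg
    have h₁ : (γ.subpath t s).lip ^ (2 + ε) ≤ γ.lip ^ (2 + ε) * |(t : ℝ) - s| ^ (1 + ε) := by
      refine (Real.rpow_le_rpow (LipPath.lip_nonneg _) (γ.lip_subpath_le s t)
        (by linarith)).trans ?_
      rw [Real.mul_rpow h₀ (abs_nonneg _)]
      refine mul_le_mul_of_nonneg_left ?_ (by positivity)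
      -- The transport is even `O(|t - s| ^ (2 + ε))`-close to `μ`; one power is given up because
      -- `|t - s| ≤ 1`.
      exact Real.rpow_le_rpow_of_exponent_ge_of_imp (abs_nonneg _) (abs_sub_le_one t s)
        (by linarith) (fun _ h => by linarith)
    have h₂ : (2 : ℝ) ≤ 2 ^ (1 + ε) := by
      simpa using Real.rpow_le_rpow_of_exponent_le one_le_two (by linarith : (1 : ℝ) ≤ 1 + ε)
    calc _ ≤ 2 ^ (1 + ε) * (Real.exp (L * γ.lip * |(t : ℝ) - s|) * ((∑ i, C i) *
            (γ.lip ^ (2 + ε) * |(t : ℝ) - s| ^ (1 + ε)))) := by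
          have := (γ.subpath t s).lip_nonneg
          gcongr ?_ * (?_ * (_ * ?_))
          exact hexp x y γ s t
      _ ≤ 2 ^ (1 + ε) * (Real.exp (L * γ.lip * |(t : ℝ) - s|) * ((∑ i, C i) *
            (γ.lip ^ (2 + ε) * |(t : ℝ) - s| ^ (1 + ε)))) *
              (riemannZeta ((2 + ε : ℝ) : ℂ)).re := le_mul_of_one_le_right (by positivity) hζ
      _ = _ := by ring
  have hunif : ∀ (x y : P) (γ : LipPath x y), ∃ A : ℝ, 0 ≤ A ∧ ∀ s t : I,
      supDist (φ.map (γ.subpath t s).cls) (μ (γ s) (γ t)) ≤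
        ENNReal.ofReal (A * |(t : ℝ) - s| ^ (1 + ε)) := by
    intro x y γ
    have h₀ := γ.lip_nonneg
    refine ⟨2 ^ (1 + ε) * γ.lip ^ (2 + ε) * Real.exp (L * γ.lip) * (∑ i, C i)
      * (riemannZeta ((2 + ε : ℝ) : ℂ)).re, by positivity, fun s t => (hclose x y γ s t).trans ?_⟩
    have h₁ : Real.exp (L * γ.lip * |(t : ℝ) - s|) ≤ Real.exp (L * γ.lip) :=
      Real.exp_le_exp.2 (mul_le_of_le_one_right (by positivity) (abs_sub_le_one t s))
    refine ENNReal.ofReal_le_ofReal ?_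
    gcongr _ * ?_ * _ * _ * _
  refine ⟨φ, hclose, fun ψ hψ => ?_, fun x y γ s t η hη => ?_, fun x y γ s t =>
    lipConst_le_of_lipschitzWith (hlip x y γ s t)⟩
  · refine ContinuousAction.eq_of_map_subpath_eq (M := M) fun x y γ => ?_
    obtain ⟨A, hA, hAφ⟩ := hunif x y γ
    obtain ⟨C', hC'⟩ := hψ x y γ
    -- Both actions are compared through `μ`; the absolute value is there because `C'` may be
    -- negative.
    refine map_subpath_eq_of_supDist_le (A := |C'| + A) (ℓ := L * γ.lip) (by positivity) hε
      (mul_nonneg hL γ.lip_nonneg) (fun s t => ?_) (fun s t => ?_)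
    · refine (supDist_triangle _ (μ (γ s) (γ t)) _).trans ?_
      rw [abs_sub_comm, add_mul, ENNReal.ofReal_add (by positivity) (by positivity)]
      refine add_le_add ((hC' s t).trans (ENNReal.ofReal_le_ofReal ?_)) ?_
      · exact mul_le_mul_of_nonneg_right (le_abs_self C') (by positivity)
      · rw [supDist_comm]
        exact hAφ s t
    · rw [abs_sub_comm]
      exact hlip x y γ s t
  · obtain ⟨A, hA, hAφ⟩ := hunif x y γ
    obtain ⟨δ, hδ, hδη⟩ := exists_ofReal_mul_rpow_lt hε
      (Real.exp (L * γ.lip * |(t : ℝ) - s|)) A |(t : ℝ) - s| hη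
    exact ⟨δ, hδ, fun l hl hm => (supDist_composite_le hA hε.le (mul_nonneg hL γ.lip_nonneg) hAφ
      (hlip x y γ) l s t hl hm.le).trans_lt hδη⟩
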